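/- Let $X_n$ be a finite-dimensional simple Lie algebra over $\mathbb C$ with simple roots $\alpha_a$, fundamental weights $\Lambda_a$ ($1\le a\le n$) and weight lattice $P=\bigoplus_a\mathbb Z\Lambda_a$; let $(\cdot|\cdot)$ be the invariant form with $(\alpha|\alpha)=2$ for long roots, and $t_a=2/(\alpha_a|\alpha_a)$. Let $H=\{(a,m): 1\le a\le n,\ m\ge 1\}$, let $\mathcal N$ be the set of finitely supported families $N=(N^{(a)}_m)_{(a,m)\in H}$ of nonnegative integers, and $$B_{am,bk}=2\min(t_bm,t_ak)-\min(t_bm,t_a(k+1))-\min(t_bm,t_a(k-1)).$$ Put $x_a=e^{\Lambda_a}$ and $y_a=e^{-\alpha_a}$, so that $y=y(x)$ is a vector of Laurent monomials in $x$. For $\nu,N\in\mathcal N$ put $$\gamma^{(a)}_m=\sum_{k\ge1}\min(m,k)\nu^{(a)}_k,\qquad P^{(a)}_m=\gamma^{(a)}_m-\sum_{(b,k)\in H}(\alpha_a|\alpha_b)\min(t_bm,t_ak)N^{(b)}_k,$$ $$K(\nu,N)=\prod_{(a,m)\in H}\binom{P^{(a)}_m+N^{(a)}_m}{N^{(a)}_m},\qquad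 R(\nu,N)=\Bigl(\det_{(a,m),(b,k)\in H'}F_{am,bk}\Bigr)\prod_{(a,m)\in H'}\frac1{N^{(a)}_m}\binom{P^{(a)}_m+N^{(a)}_m-1}{N^{(a)}_m-1},$$ where $H'=\{(a,m)\in H: N^{(a)}_m>0\}$, $F_{am,bk}=\delta_{ab}\delta_{mk}P^{(a)}_m+(\alpha_a|\alpha_b)\min(t_bm,t_ak)N^{(b)}_k$, $\binom{z}{j}=z(z-1)\cdots(z-j+1)/j!$, and $R(\nu,0)=1$. Let $$\tilde R^\nu(y)=\sum_{N\in\mathcal N}R(\nu,N)\prod_{a}y_a^{\sum_m mN^{(a)}_m},\qquad \tilde K^\nu(y)=\sum_{N\in\mathcal N}K(\nu,N)\prod_{a}y_a^{\sum_m mN^{(a)}_m}$$ in $\mathbb C[[y]]$, and $R^\nu(x)=\bigl(\prod_{(a,m)}x_a^{m\nu^{(a)}_m}\bigr)\tilde R^\nu(y(x))$, $K^\nu(x)=\bigl(\prod_{(a,m)}x_a^{m\nu^{(a)}_m}\bigr)\tilde K^\nu(y(x))$. There is exactly one family $(\tilde Q^{(a)}_m(y))_{(a,m)\in H}$ of invertible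 elements of $\mathbb C[[y]]$ which, with $\tilde Q^{(a)}_0=1$, satisfies $$(\tilde Q^{(a)}_m)^2=\tilde Q^{(a)}_{m+1}\tilde Q^{(a)}_{m-1}+y_a^m(\tilde Q^{(a)}_m)^2\prod_{(b,k)\in H}(\tilde Q^{(b)}_k)^{-(\alpha_a|\alpha_b)B_{am,bk}}\qquad((a,m)\in H)$$ and for which $\lim_{m\to\infty}\tilde Q^{(a)}_m$ exists in $\mathbb C[[y]]$ for every $a$ (in the standard topology of the formal power series ring: every coefficient is eventually constant). Put $Q^{(a)}_m(x)=x_a^m\tilde Q^{(a)}_m(y(x))$, $\tilde Q^\nu(y)=\prod_{(a,m)\in H}(\tilde Q^{(a)}_m(y))^{\nu^{(a)}_m}$ and $Q^\nu(x)=\prod_{(a,m)\in H}(Q^{(a)}_m(x))^{\nu^{(a)}_m}$. Then $\tilde K^0(y)$ and $K^0(x)$ are invertible, and for every $\nu\in\mathcal N$ $$\tilde Q^\nu(y)=\tilde R^\nu(y)=\tilde K^\nu(y)/\tilde K^0(y),\qquad Q^\nu(x)=R^\nu(x)=K^\nu(x)/K^0(x).$$ Moreover, writing $Q^\nu(x)=\sum_{\lambda\in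 P}r^\nu_\lambda e^\lambda$, for every $\lambda\in P$ the set $$\mathcal N^\nu_\lambda=\Bigl\{N\in\mathcal N:\ \sum_{(a,m)\in H}m\nu^{(a)}_m\Lambda_a-\sum_{(a,m)\in H}mN^{(a)}_m\alpha_a=\lambda\Bigr\}$$ is finite and $r^\nu_\lambda=\sum_{N\in\mathcal N^\nu_\lambda}R(\nu,N)$. -/

import Mathlib

open Filter
open scoped BigOperators

namespace BetheQ

noncomputable section

variable {ι 𝕜 V W : Type*} [Fintype ι] [Field 𝕜] [CharZero 𝕜]
  [AddCommGroup V] [Module 𝕜 V] [AddCommGroup W] [Module 𝕜 W]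
  {P : RootPairing ι 𝕜 V W} [P.IsCrystallographic]

/-! ### Normalised invariant form

Throughout, `P` is the root system of `X_n` and `b` is a base.  The nodes of the Dynkin diagram are
the elements of `b.support`, and the simple root `α_a` is `P.root a`. -/

variable (P) in
/-- The square length of a longest root for the canonical Weyl group invariant form
`P.RootFormIn ℤ`. -/
def maxLength : ℤ :=
  ⨆ i : ι, P.RootFormIn ℤ (P.rootSpanMem ℤ i) (P.rootSpanMem ℤ i)

/-- The number `(α_a | α_c)`: the Weyl group invariant form on simple roots, rescaled so that
`(α | α) = 2` for a long root `α`. -/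
def form (b : P.Base) (a c : b.support) : ℚ :=
  2 * (P.RootFormIn ℤ (P.rootSpanMem ℤ (a : ι)) (P.rootSpanMem ℤ (c : ι)) : ℚ) / (maxLength P : ℚ)

/-- `t_a = 2 / (α_a | α_a)`. -/
def t (b : P.Base) (a : b.support) : ℚ := 2 / form b a a

/-- The index set of pairs `(a, m)` with `a` a node of the Dynkin diagram and `m ≥ 1`. -/
abbrev Idx (b : P.Base) : Type _ := b.support × ℕ+

/-- Finitely supported families of nonnegative integers `N_m^{(a)}`: the quantum space data `ν`,
and also the string patterns `N`. -/
abbrev Pattern (b : P.Base) : Type _ := Idx b →₀ ℕ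

/-- `(α_a | α_c) min (t_c m, t_a k)`. -/
def formMin (b : P.Base) (h g : Idx b) : ℚ :=
  form b h.1 g.1 * min (t b g.1 * (h.2 : ℕ)) (t b h.1 * (g.2 : ℕ))

/-- `B_{am,ck} = 2 min (t_c m, t_a k) - min (t_c m, t_a (k+1)) - min (t_c m, t_a (k-1))`. -/
def bFun (b : P.Base) (h g : Idx b) : ℚ :=
  2 * min (t b g.1 * (h.2 : ℕ)) (t b h.1 * (g.2 : ℕ))
    - min (t b g.1 * (h.2 : ℕ)) (t b h.1 * ((g.2 : ℕ) + 1))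
    - min (t b g.1 * (h.2 : ℕ)) (t b h.1 * ((g.2 : ℕ) - 1))

/-- The integer `(α_a | α_c) B_{am,ck}`; see `cast_formB`. -/
def formB (b : P.Base) (h g : Idx b) : ℤ := ⌊form b h.1 g.1 * bFun b h g⌋

lemma length_pos (i : ι) :
    0 < P.RootFormIn ℤ (P.rootSpanMem ℤ i) (P.rootSpanMem ℤ i) := by
  have := (P.posRootForm ℤ).rootLength_pos i
  rwa [RootPairing.RootPositiveForm.rootLength, RootPairing.posRootForm_eq] at this

lemma maxLength_pos (i : ι) : 0 < maxLength P :=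
  lt_of_lt_of_le (length_pos i)
    (le_ciSup (f := fun j : ι => P.RootFormIn ℤ (P.rootSpanMem ℤ j) (P.rootSpanMem ℤ j))
      (Set.finite_range _).bddAbove i)

lemma form_self_pos (b : P.Base) (a : b.support) : 0 < form b a a := by
  have h1 : (0 : ℚ) < P.RootFormIn ℤ (P.rootSpanMem ℤ (a : ι)) (P.rootSpanMem ℤ (a : ι)) := by
    exact_mod_cast length_pos (P := P) (a : ι)
  have h2 : (0 : ℚ) < maxLength P := by exact_mod_cast maxLength_pos (P := P) (a : ι)
  unfold form
  positivity

lemma t_pos (b : P.Base) (a : b.support) : 0 < t b a := div_pos two_pos (form_self_pos b a)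

lemma form_comm (b : P.Base) (a c : b.support) : form b a c = form b c a := by
  unfold form
  rw [(P.rootFormIn_isSymm ℤ).eq (P.rootSpanMem ℤ (c : ι)) (P.rootSpanMem ℤ (a : ι)) |>.symm]
  simp

/-- `t_c (α_a | α_c)` is an entry of the Cartan matrix. -/
lemma form_mul_t (b : P.Base) (a c : b.support) :
    form b a c * t b c = (b.cartanMatrix a c : ℚ) := by
  have hc := (form_self_pos b c).ne'
  have h2 : (maxLength P : ℚ) ≠ 0 := by exact_mod_cast (maxLength_pos (P := P) (c : ι)).ne'
  have key : 2 * P.RootFormIn ℤ (P.rootSpanMem ℤ (a : ι)) (P.rootSpanMem ℤ (c : ι)) =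
      P.pairingIn ℤ a c * P.RootFormIn ℤ (P.rootSpanMem ℤ (c : ι)) (P.rootSpanMem ℤ (c : ι)) := by
    have := (P.posRootForm ℤ).two_mul_apply_root_root (a : ι) (c : ι)
    apply FaithfulSMul.algebraMap_injective ℤ 𝕜
    rw [map_mul, map_mul, RootPairing.algebraMap_pairingIn, RootPairing.algebraMap_rootFormIn,
      RootPairing.algebraMap_rootFormIn]
    simpa [RootPairing.posRootForm] using this
  have key' : (2 : ℚ) * P.RootFormIn ℤ (P.rootSpanMem ℤ (a : ι)) (P.rootSpanMem ℤ (c : ι)) =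
      P.pairingIn ℤ a c *
        P.RootFormIn ℤ (P.rootSpanMem ℤ (c : ι)) (P.rootSpanMem ℤ (c : ι)) := by
    exact_mod_cast key
  have h3 : form b a c = (P.pairingIn ℤ a c : ℚ) * form b c c / 2 := by
    unfold form
    rw [key']
    ring
  rw [t, h3, RootPairing.Base.cartanMatrix, RootPairing.Base.cartanMatrixIn_def]
  field_simp

private lemma form_min_int (b : P.Base) (a c : b.support) (m k : ℤ) :
    ∃ z : ℤ, form b a c * min (t b c * m) (t b a * k) = z := by
  rcases min_choice (t b c * m) (t b a * k) with h | h
  · exact ⟨b.cartanMatrix a c * m, by rw [h, ← mul_assoc, form_mul_t]; push_cast; ring⟩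
  · exact ⟨b.cartanMatrix c a * k, by
      rw [h, ← mul_assoc, form_comm, form_mul_t]; push_cast; ring⟩

/-- The exponents of the `Q`-system are integers. -/
lemma cast_formB (b : P.Base) (h g : Idx b) :
    (formB b h g : ℚ) = form b h.1 g.1 * bFun b h g := by
  obtain ⟨x, hx⟩ := form_min_int b h.1 g.1 (h.2 : ℕ) (g.2 : ℕ)
  obtain ⟨y, hy⟩ := form_min_int b h.1 g.1 (h.2 : ℕ) ((g.2 : ℕ) + 1)
  obtain ⟨z, hz⟩ := form_min_int b h.1 g.1 (h.2 : ℕ) ((g.2 : ℕ) - 1)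
  push_cast at hx hy hz
  have : form b h.1 g.1 * bFun b h g = ((2 * x - y - z : ℤ) : ℚ) := by
    push_cast
    rw [← hx, ← hy, ← hz, bFun]
    ring
  rw [formB, this, Int.floor_intCast]

/-- For fixed `(a, m)` only finitely many exponents are nonzero. -/
lemma finite_formB (b : P.Base) (h : Idx b) : {g : Idx b | formB b h g ≠ 0}.Finite := by
  obtain ⟨M, hM⟩ : ∃ M : ℕ, ∀ c : b.support, t b c * (h.2 : ℕ) / t b h.1 ≤ M := by
    obtain ⟨M, hM⟩ := exists_nat_ge (∑ c : b.support, t b c * (h.2 : ℕ) / t b h.1)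
    refine ⟨M, fun c => le_trans ?_ hM⟩
    refine Finset.single_le_sum (f := fun c : b.support => t b c * (h.2 : ℕ) / t b h.1)
      (fun i _ => ?_) (Finset.mem_univ c)
    have := t_pos b i
    have := t_pos b h.1
    positivity
  refine (Set.finite_univ.prod (Set.finite_Iic (⟨M + 1, M.succ_pos⟩ : ℕ+))).subset ?_
  intro (g : Idx b) hg
  refine ⟨Set.mem_univ _, ?_⟩
  by_contra hlt
  have hlt' : M + 1 < (g.2 : ℕ) := by
    have h' : (⟨M + 1, M.succ_pos⟩ : ℕ+) < g.2 := not_le.mp hlt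
    exact PNat.coe_lt_coe _ _ |>.mpr h'
  have hg2 : (M : ℚ) ≤ (g.2 : ℕ) - 1 := by
    have : ((M + 1 : ℕ) : ℚ) ≤ (g.2 : ℕ) := by exact_mod_cast hlt'.le
    push_cast at this
    linarith
  have ht := t_pos b h.1
  have h1 : t b g.1 * (h.2 : ℕ) ≤ t b h.1 * ((g.2 : ℕ) - 1) := by
    have := (hM g.1).trans hg2
    rw [div_le_iff₀ ht] at this
    linarith
  have hB : bFun b h g = 0 := by
    rw [bFun, min_eq_left h1, min_eq_left (by nlinarith), min_eq_left (by nlinarith)]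
    ring
  exact hg (by rw [formB, hB]; simp)

/-! ### The `Q`-system

`MvPowerSeries b.support ℂ` is the ring `ℂ[[y]]` of formal power series in the variables
`y_a = e^{-α_a}`. -/

/-- The `Q`-system for a family `Q_m^{(a)}` of invertible power series of `y`. -/
def QSystem (b : P.Base) (Q : b.support → ℕ → (MvPowerSeries b.support ℂ)ˣ) : Prop :=
  (∀ a, Q a 0 = 1) ∧
  ∀ (a : b.support) (m : ℕ+),
    (Q a m : MvPowerSeries b.support ℂ) ^ 2 =
      (Q a ((m : ℕ) + 1) : MvPowerSeries b.support ℂ) * (Q a ((m : ℕ) - 1) : MvPowerSeries b.support ℂ)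
      + MvPowerSeries.X a ^ (m : ℕ) * (Q a m : MvPowerSeries b.support ℂ) ^ 2 *
        ((∏ᶠ g : Idx b, Q g.1 g.2 ^ (-formB b (a, m) g) : (MvPowerSeries b.support ℂ)ˣ) :
          MvPowerSeries b.support ℂ)

/-- The convergence property: for every `a` the limit of `Q_m^{(a)}` as `m → ∞` exists in `ℂ[[y]]`
with its standard topology as a formal power series ring, that is, `ℂ` is discrete and every
coefficient is eventually constant. -/
def QConverges (b : P.Base) (Q : b.support → ℕ → (MvPowerSeries b.support ℂ)ˣ) : Prop :=
  ∀ a, ∃ L : MvPowerSeries b.support ℂ,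
    Tendsto (fun m => (Q a m : MvPowerSeries b.support ℂ)) atTop
      (@nhds _ (@MvPowerSeries.WithPiTopology.instTopologicalSpace b.support ℂ ⊥) L)

/-! ### The numbers `R(ν, N)` and `K(ν, N)` -/

/-- The binomial coefficient `x (x - 1) ⋯ (x - j + 1) / j!`. -/
def binom (x : ℚ) (j : ℕ) : ℚ := (∏ i ∈ Finset.range j, (x - i)) / (j.factorial : ℚ)

open scoped Classical in
/-- `γ_m^{(a)}(ν) = ∑_k min (m, k) ν_k^{(a)}`. -/
def gam (b : P.Base) (ν : Pattern b) (h : Idx b) : ℚ :=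
  ν.sum fun g n => if g.1 = h.1 then min ((h.2 : ℕ) : ℚ) ((g.2 : ℕ) : ℚ) * n else 0

/-- `P_m^{(a)}(ν, N) = γ_m^{(a)}(ν) - ∑_{(c,k)} (α_a | α_c) min (t_c m, t_a k) N_k^{(c)}`. -/
def vac (b : P.Base) (ν N : Pattern b) (h : Idx b) : ℚ :=
  gam b ν h - N.sum fun g n => formMin b h g * n

open scoped Classical in
/-- The matrix `F`, indexed by `{(a, m) | N_m^{(a)} > 0}`. -/
def matF (b : P.Base) (ν N : Pattern b) : Matrix N.support N.support ℚ :=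
  Matrix.of fun h g => (if h = g then vac b ν N h else 0) + formMin b h g * N g

open scoped Classical in
/-- `R(ν, N)`.  For `N = 0` the determinant and the product are empty, so `R(ν, 0) = 1`. -/
def numR (b : P.Base) (ν N : Pattern b) : ℚ :=
  (matF b ν N).det * ∏ h ∈ N.support, 1 / (N h : ℚ) * binom (vac b ν N h + N h - 1) (N h - 1)

lemma numR_zero (b : P.Base) (ν : Pattern b) : numR b ν 0 = 1 := by
  classical
  have : IsEmpty (0 : Pattern b).support := ⟨fun x => absurd x.2 (Finset.notMem_empty _)⟩
  simp [numR, Matrix.det_isEmpty]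

/-- `K(ν, N)`; the factors with `N_m^{(a)} = 0` are `1`. -/
def numK (b : P.Base) (ν N : Pattern b) : ℚ :=
  ∏ h ∈ N.support, binom (vac b ν N h + N h) (N h)

/-! ### Generating series in `y` -/

/-- The exponent `(∑_m m N_m^{(a)})_a` of `y` attached to `N`. -/
def content (b : P.Base) (N : Pattern b) : b.support →₀ ℕ :=
  N.sum fun h n => Finsupp.single h.1 ((h.2 : ℕ) * n)

lemma le_content (b : P.Base) (N : Pattern b) (h : Idx b) :
    (h.2 : ℕ) * N h ≤ content b N h.1 := by
  classical
  by_cases hN : h ∈ N.support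
  · rw [content, Finsupp.sum, Finsupp.finsetSum_apply]
    refine le_trans ?_ (Finset.single_le_sum
      (f := fun g : Idx b => Finsupp.single g.1 ((g.2 : ℕ) * N g) h.1) (fun _ _ => Nat.zero_le _) hN)
    simp
  · simp [Finsupp.notMem_support_iff.mp hN]

lemma finite_content (b : P.Base) (d : b.support →₀ ℕ) : {N | content b N = d}.Finite := by
  classical
  set S : Finset (Idx b) :=
    Finset.univ ×ˢ (Finset.Icc 1 (⟨d.degree + 1, Nat.succ_pos _⟩ : ℕ+)) with hS
  set f : Pattern b := Finsupp.onFinset S (fun h => if h ∈ S then d.degree else 0)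
    (fun h hh => by by_contra h'; simp [h'] at hh) with hf
  refine (Set.finite_Iic f).subset ?_
  rintro N rfl h
  have h1 := (le_content b N h).trans (Finsupp.le_degree h.1 (content b N))
  by_cases h0 : N h = 0
  · simp [h0]
  · have hmem : h ∈ S := by
      refine Finset.mem_product.mpr ⟨Finset.mem_univ _, Finset.mem_Icc.mpr ⟨h.2.pos, ?_⟩⟩
      have := Nat.le_mul_of_pos_right (h.2 : ℕ) (Nat.pos_of_ne_zero h0)
      have h2 : (h.2 : ℕ) ≤ (content b N).degree + 1 := by omega
      exact h2
    rw [hf, Finsupp.onFinset_apply, if_pos hmem]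
    exact (Nat.le_mul_of_pos_left _ h.2.pos).trans h1

/-- The power series `∑_N c(N) ∏_a y_a ^ (∑_m m N_m^{(a)})`. -/
def genSeries (b : P.Base) (c : Pattern b → ℚ) : MvPowerSeries b.support ℂ :=
  fun d => ((∑ N ∈ (finite_content b d).toFinset, c N : ℚ) : ℂ)

/-- The generating series of `R(ν, N)` as a power series of `y`. -/
def Rtilde (b : P.Base) (ν : Pattern b) : MvPowerSeries b.support ℂ := genSeries b (numR b ν)

/-- The generating series of `K(ν, N)` as a power series of `y`. -/
def Ktilde (b : P.Base) (ν : Pattern b) : MvPowerSeries b.support ℂ := genSeries b (numK b ν)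

/-- `∏ (Q_m^{(a)}(y)) ^ ν_m^{(a)}` as a power series of `y`. -/
def Qtilde (b : P.Base) (Q : b.support → ℕ → (MvPowerSeries b.support ℂ)ˣ) (ν : Pattern b) :
    MvPowerSeries b.support ℂ :=
  ν.prod fun h n => (Q h.1 h.2 : MvPowerSeries b.support ℂ) ^ n

/-! ### The weight lattice and Laurent series in `x` -/

/-- The weight lattice, in the basis of fundamental weights: `λ : b.support → ℤ` stands for
`∑_a λ_a Λ_a`. -/
def Weight (b : P.Base) : Type _ := b.support → ℤ

instance (b : P.Base) : AddCommGroup (Weight b) := inferInstanceAs (AddCommGroup (b.support → ℤ))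

open scoped Classical in
/-- The fundamental weight `Λ_a`. -/
def fundWeight (b : P.Base) (a : b.support) : Weight b := (Pi.single a 1 : b.support → ℤ)

/-- The simple root `α_a = ∑_c ⟨α_a, α_c^∨⟩ Λ_c` as a weight. -/
def simpleRoot (b : P.Base) (a : b.support) : Weight b := (b.cartanMatrix a : b.support → ℤ)

/-- The weight `-∑_a d_a α_a` of the monomial `∏_a y_a ^ d_a`. -/
def yWeight (b : P.Base) : (b.support →₀ ℕ) →+ Weight b where
  toFun d := -d.sum fun a n => n • simpleRoot b a
  map_zero' := by simp
  map_add' d e := by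
    rw [Finsupp.sum_add_index' (by simp) (by intros; rw [add_smul]), neg_add]

variable [P.IsRootSystem]

lemma yWeight_injective (b : P.Base) : Function.Injective (yWeight b) := by
  classical
  intro d e hde
  have h1 : ∀ d : b.support →₀ ℕ,
      (yWeight b d : b.support → ℤ) = -Matrix.vecMul (fun a => (d a : ℤ)) b.cartanMatrix := by
    intro d
    funext c
    change (-(d.sum fun a n => n • (b.cartanMatrix a : b.support → ℤ)) : b.support → ℤ) c = _
    rw [Finsupp.sum_fintype _ _ (by simp)]
    simp [Matrix.vecMul, dotProduct]
  have h2 : Matrix.vecMul (fun a => (d a : ℤ) - (e a : ℤ)) b.cartanMatrix = 0 := by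
    have h3 := neg_injective ((h1 d).symm.trans (hde.trans (h1 e)))
    have : (fun a => (d a : ℤ) - (e a : ℤ)) = (fun a => (d a : ℤ)) - fun a => (e a : ℤ) := rfl
    rw [this, Matrix.sub_vecMul, h3, sub_self]
  have h4 := Matrix.eq_zero_of_vecMul_eq_zero
    (Matrix.nondegenerate_iff_det_ne_zero.mp b.cartanMatrix_nondegenerate) h2
  ext a
  have := congrFun h4 a
  simp only [Pi.zero_apply] at this
  omega

/-- `μ` follows `lam` when `lam - μ` is a sum of simple roots.  This is the opposite of the
dominance order, so that Hahn series for this order extend infinitely in the directions `-α_a`. -/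
instance (b : P.Base) : PartialOrder (Weight b) where
  le lam μ := ∃ d : b.support →₀ ℕ, μ = lam + yWeight b d
  le_refl lam := ⟨0, by simp⟩
  le_trans := by
    rintro x y z ⟨d, rfl⟩ ⟨e, rfl⟩
    exact ⟨d + e, by rw [map_add, add_assoc]⟩
  le_antisymm := by
    rintro x y ⟨d, rfl⟩ ⟨e, he⟩
    have h0 : yWeight b (d + e) = yWeight b 0 := by
      rw [map_zero, map_add]
      rw [add_assoc] at he
      exact (left_eq_add.mp he)
    have := yWeight_injective b h0
    have hd : d = 0 := by
      ext a
      have := DFunLike.congr_fun this a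
      simp only [Finsupp.add_apply, Finsupp.zero_apply] at this
      simp only [Finsupp.zero_apply]
      omega
    simp [hd]

instance (b : P.Base) : IsOrderedCancelAddMonoid (Weight b) where
  add_le_add_left := by
    rintro x y ⟨d, rfl⟩ z
    exact ⟨d, by abel⟩
  le_of_add_le_add_left := by
    rintro x y z ⟨d, hd⟩
    exact ⟨d, by rw [add_assoc] at hd; exact add_left_cancel hd⟩

lemma yWeight_le_iff (b : P.Base) (d e : b.support →₀ ℕ) :
    yWeight b d ≤ yWeight b e ↔ d ≤ e := by
  constructor
  · rintro ⟨f, hf⟩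
    rw [← map_add] at hf
    rw [yWeight_injective b hf]
    exact le_self_add
  · intro h
    exact ⟨e - d, by rw [← map_add, add_tsub_cancel_of_le h]⟩

/-- Laurent series of `x`: formal sums `∑_λ c_λ e^λ` over the weight lattice, where
`x_a = e^{Λ_a}`. -/
abbrev LaurentSeriesX (b : P.Base) : Type _ := HahnSeries (Weight b) ℂ

/-- The formal exponential `e^λ`. -/
def expo (b : P.Base) (lam : Weight b) : LaurentSeriesX b := HahnSeries.single lam 1

/-- The substitution `f(y) ↦ f(y(x))`, that is, `y_a = e^{-α_a}`. -/
def substY (b : P.Base) : MvPowerSeries b.support ℂ →+* LaurentSeriesX b :=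
  (HahnSeries.embDomainRingHom (yWeight b) (yWeight_injective b) (yWeight_le_iff b)).comp
    (HahnSeries.toMvPowerSeries (σ := b.support) (R := ℂ)).symm.toRingHom

/-- The highest weight `∑_{(a,m)} m ν_m^{(a)} Λ_a`. -/
def topWeight (b : P.Base) (ν : Pattern b) : Weight b :=
  ν.sum fun h n => ((h.2 : ℕ) * n) • fundWeight b h.1

/-- `Q_m^{(a)}(x) = x_a^m Q_m^{(a)}(y(x))`. -/
def Qx (b : P.Base) (Q : b.support → ℕ → (MvPowerSeries b.support ℂ)ˣ) (a : b.support) (m : ℕ) :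
    LaurentSeriesX b :=
  expo b (fundWeight b a) ^ m * substY b (Q a m)

/-- `Q^ν(x) = ∏ (Q_m^{(a)}(x)) ^ ν_m^{(a)}`. -/
def Qnu (b : P.Base) (Q : b.support → ℕ → (MvPowerSeries b.support ℂ)ˣ) (ν : Pattern b) :
    LaurentSeriesX b :=
  ν.prod fun h n => Qx b Q h.1 h.2 ^ n

/-- `R^ν(x) = (∏ x_a ^ (m ν_m^{(a)})) R^ν(y(x))`. -/
def Rnu (b : P.Base) (ν : Pattern b) : LaurentSeriesX b :=
  (ν.prod fun h n => expo b (fundWeight b h.1) ^ ((h.2 : ℕ) * n)) * substY b (Rtilde b ν)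

/-- `K^ν(x) = (∏ x_a ^ (m ν_m^{(a)})) K^ν(y(x))`. -/
def Knu (b : P.Base) (ν : Pattern b) : LaurentSeriesX b :=
  (ν.prod fun h n => expo b (fundWeight b h.1) ^ ((h.2 : ℕ) * n)) * substY b (Ktilde b ν)

/-- The set of `N` with `∑ m ν_m^{(a)} Λ_a - ∑ m N_m^{(a)} α_a = λ`. -/
def patternsOfWeight (b : P.Base) (ν : Pattern b) (lam : Weight b) : Set (Pattern b) :=
  {N | topWeight b ν - (N.sum fun h n => ((h.2 : ℕ) * n) • simpleRoot b h.1) = lam}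

end

end BetheQ

namespace BetheQ

noncomputable section

set_option linter.unusedSectionVars false

variable {ι 𝕜 V W : Type*} [Fintype ι] [Field 𝕜] [CharZero 𝕜]
  [AddCommGroup V] [Module 𝕜 V] [AddCommGroup W] [Module 𝕜 W]
  {P : RootPairing ι 𝕜 V W} [P.IsCrystallographic]

/-! The `Q`-system is nonlinear in the `Q_m^{(a)}`, but multiplying it by an arbitrary monomial
makes it linear in the family of all monomials `X(ν) = Q^ν`, with `ν` an integral pattern: `X(ν) -
X(ν - δ_h) = y_a^m X(ν - β_h)`. Here `δ_h` is the negative second difference of basis patterns at `h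
= (a, m)` and `β_h` is the row of exponents `(α_a | α_c) B_{am,ck}` (`qSystem_iff`). The series of
`K` and `R`, extended to integral `ν`, satisfy the same recursion: `γ` sends `δ_h` to the unit
vector at `h` and `β_h` to the column `(α | α) min` at `h`, and the coefficients obey a Pascal rule
(`IsPascal`), which acts in one factor of `K` and in one column of the determinant for `R`.

The limit condition becomes stability: modulo any given degree, shifting `ν` by a first difference
at a high level changes nothing. The heart is the exchange identity `X(p - r) Y(q) = X(p) Y(q - r)`
for two stable solutions (`IsRecursive.exchange`), proved degree by degree. For `r = δ_h` the
recursion turns the defect into `y_a^m` times another defect, which gains a degree; for `r` a high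
first difference stability suffices; and these `r` generate all patterns.

Three instances finish the proof. `K` against itself shows that `K^ν / K^0` is multiplicative in
`ν`, so these quotients are the monomials of a solution. `K` against `R`, with `R^0 = 1`, gives `R^ν
K^0 = K^ν`. Any solution against this one gives uniqueness. -/

/-! ### Power series of order at least `d` -/

/-- The ideal of power series all of whose terms have degree at least `d`. -/
def orderIdeal (σ : Type*) (d : ℕ) : Ideal (MvPowerSeries σ ℂ) where
  carrier := {f | (d : ℕ∞) ≤ f.order}
  zero_mem' := by simp
  add_mem' {f g} hf hg := (le_min hf hg).trans MvPowerSeries.min_order_le_add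
  smul_mem' c f hf := by
    simp only [Set.mem_ofPred_eq, smul_eq_mul] at hf ⊢
    exact (hf.trans le_add_self).trans MvPowerSeries.le_order_mul

lemma mem_orderIdeal {σ : Type*} {d : ℕ} {f : MvPowerSeries σ ℂ} :
    f ∈ orderIdeal σ d ↔ ∀ n : σ →₀ ℕ, n.degree < d → MvPowerSeries.coeff n f = 0 := by
  change (d : ℕ∞) ≤ f.order ↔ _
  constructor
  · intro h n hn
    exact MvPowerSeries.coeff_of_lt_order (lt_of_lt_of_le (by exact_mod_cast hn) h)
  · intro h
    exact MvPowerSeries.le_order fun n hn => h n (by exact_mod_cast hn)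

lemma eq_of_sub_mem_orderIdeal {σ : Type*} {f g : MvPowerSeries σ ℂ}
    (h : ∀ d, f - g ∈ orderIdeal σ d) : f = g := by
  ext n
  have := mem_orderIdeal.mp (h (n.degree + 1)) n (Nat.lt_succ_self _)
  rwa [map_sub, sub_eq_zero] at this

/-- This gain of a degree, which needs `m ≥ 1`, drives the induction in `IsRecursive.exchange`. -/
lemma X_pow_mul_mem_orderIdeal {σ : Type*} {d : ℕ} {f : MvPowerSeries σ ℂ} (a : σ) (m : ℕ+)
    (hf : f ∈ orderIdeal σ d) : MvPowerSeries.X a ^ (m : ℕ) * f ∈ orderIdeal σ (d + 1) := by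
  classical
  rw [mem_orderIdeal] at hf ⊢
  intro n hn
  rw [MvPowerSeries.X_pow_eq, MvPowerSeries.coeff_monomial_mul]
  split_ifs with h
  · rw [hf, mul_zero]
    have h1 : n.degree = (n - Finsupp.single a (m : ℕ)).degree + (m : ℕ) := by
      conv_lhs => rw [← tsub_add_cancel_of_le h]
      rw [map_add, Finsupp.degree_single]
    have := m.pos
    omega
  · rfl

/-! ### Families indexed by integral patterns -/

/-- Finitely supported families of integers indexed by nodes and levels. -/
abbrev IntPattern (σ : Type*) : Type _ := σ × ℕ+ →₀ ℤ

/-- The basis pattern at node `a` and level `m`, which is `0` for `m = 0`. -/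
def level {σ : Type*} (a : σ) (m : ℕ) : IntPattern σ :=
  if h : 0 < m then Finsupp.single (a, ⟨m, h⟩) 1 else 0

/-- The difference of two consecutive basis patterns. -/
def levelStep {σ : Type*} (a : σ) (m : ℕ) : IntPattern σ := level a (m + 1) - level a m

/-- The negative second difference of basis patterns at `(a, m)`. -/
def levelBend {σ : Type*} (h : σ × ℕ+) : IntPattern σ :=
  level h.1 h.2 + level h.1 h.2 - level h.1 ((h.2 : ℕ) + 1) - level h.1 ((h.2 : ℕ) - 1)

lemma level_zero {σ : Type*} (a : σ) : level a 0 = 0 := by simp [level]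

lemma level_coe {σ : Type*} (a : σ) (m : ℕ+) : level a (m : ℕ) = Finsupp.single (a, m) 1 := by
  simp only [level, m.pos, dif_pos]
  rfl

lemma levelStep_pred {σ : Type*} (a : σ) (m : ℕ) :
    levelStep a m = levelBend (a, m.succPNat) + levelStep a (m + 1) := by
  simp only [levelStep, levelBend, Nat.succPNat_coe, Nat.succ_eq_add_one, Nat.add_sub_cancel]
  abel

/-- A subgroup that contains all second differences and, for every node, one first difference
of basis patterns is everything. -/
lemma eq_top_of_levelBend_mem {σ : Type*} {G : AddSubgroup (IntPattern σ)} {M : ℕ}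
    (h1 : ∀ h, levelBend h ∈ G) (h2 : ∀ a, levelStep a M ∈ G) (ν : IntPattern σ) : ν ∈ G := by
  -- From the single step at level `M`, the bends give every lower step by descent and, in `h3'`,
  -- every higher step by ascent. The basis patterns are then telescoping sums starting from `level
  -- a 0 = 0`.
  have h3 : ∀ a : σ, ∀ j m, m + j = M → levelStep a m ∈ G := by
    intro a j
    induction j with
    | zero => rintro m rfl; exact h2 a
    | succ j ih =>
      intro m hm
      rw [levelStep_pred]
      exact G.add_mem (h1 _) (ih (m + 1) (by omega))
  have h3' : ∀ a : σ, ∀ m, levelStep a (M + m) ∈ G := by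
    intro a m
    induction m with
    | zero => exact h2 a
    | succ m ih =>
      rw [levelStep_pred] at ih
      exact (G.add_mem_cancel_left (h1 _)).mp ih
  have h4 : ∀ (a : σ) m, level a m ∈ G := by
    intro a m
    induction m with
    | zero => rw [level_zero]; exact G.zero_mem
    | succ m ih =>
      have : levelStep a m ∈ G := by
        rcases le_total m M with h | h
        · exact h3 a (M - m) m (by omega)
        · obtain ⟨k, rfl⟩ := Nat.exists_eq_add_of_le h
          exact h3' a k
      have h5 : level a (m + 1) = levelStep a m + level a m := by simp [levelStep]
      rw [h5]
      exact G.add_mem this ih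
  induction ν using Finsupp.induction_linear with
  | zero => exact G.zero_mem
  | add f g hf hg => exact G.add_mem hf hg
  | single h n =>
    have : Finsupp.single h n = n • level h.1 (h.2 : ℕ) := by
      rw [level_coe]; simp
    rw [this]
    exact G.zsmul_mem (h4 _ _) n

/-! ### Linear recursions and the exchange identity -/

/-- The linear form of the `Q`-system for a family of power series. -/
def IsRecursive {σ : Type*} (β : σ × ℕ+ → IntPattern σ)
    (X : IntPattern σ → MvPowerSeries σ ℂ) : Prop :=
  ∀ ν h, X ν - X (ν - levelBend h) = MvPowerSeries.X h.1 ^ (h.2 : ℕ) * X (ν - β h)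

/-- The family does not see high levels in low degrees. -/
def IsStable {σ : Type*} (X : IntPattern σ → MvPowerSeries σ ℂ) : Prop :=
  ∀ d : ℕ, ∃ M : ℕ, ∀ m, M ≤ m → ∀ a ν, X (ν - levelStep a m) - X ν ∈ orderIdeal σ d

/-- Two stable families with the same linear recursion are proportional. -/
lemma IsRecursive.exchange {σ : Type*} {β : σ × ℕ+ → IntPattern σ}
    {X Y : IntPattern σ → MvPowerSeries σ ℂ} (hX : IsRecursive β X) (hY : IsRecursive β Y)
    (sX : IsStable X) (sY : IsStable Y) (p q r : IntPattern σ) :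
    X (p - r) * Y q = X p * Y (q - r) := by
  refine eq_of_sub_mem_orderIdeal fun d => ?_
  induction d generalizing p q r with
  | zero => exact mem_orderIdeal.mpr fun n hn => absurd hn (Nat.not_lt_zero _)
  | succ d ih =>
    obtain ⟨M, hM⟩ := sX (d + 1)
    obtain ⟨M', hM'⟩ := sY (d + 1)
    -- The shifts `r` for which the identity holds modulo degree `d + 1` form a subgroup because `p`
    -- and `q` are arbitrary: for `r + s`, move `r` across with `p - s` as base point, then `s` with
    -- `q - r`.
    let G : AddSubgroup (IntPattern σ) :=
      { carrier := {r | ∀ p q, X (p - r) * Y q - X p * Y (q - r) ∈ orderIdeal σ (d + 1)}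
        zero_mem' := by simp
        add_mem' := by
          intro r s hr hs p q
          have h1 := hr (p - s) q
          have h2 := hs p (q - r)
          have := add_mem h1 h2
          rw [sub_add_sub_cancel] at this
          rwa [add_comm r s, ← sub_sub, add_comm s r, ← sub_sub]
        neg_mem' := by
          intro r hr p q
          have := neg_mem (hr (p + r) (q + r))
          simpa using this }
    refine eq_top_of_levelBend_mem (G := G) (M := max M M') (fun h p q => ?_) (fun a p q => ?_) r p q
    -- The cross terms `X p * Y q` cancel, leaving `y_a^m` times the defect for `r = β h`, which is
    -- small to order `d` by induction.
    · have h1 := hX p h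
      have h2 := hY q h
      have h3 : X (p - levelBend h) * Y q - X p * Y (q - levelBend h) =
          MvPowerSeries.X h.1 ^ (h.2 : ℕ) * -(X (p - β h) * Y q - X p * Y (q - β h)) := by
        linear_combination X p * h2 - Y q * h1
      rw [h3]
      exact X_pow_mul_mem_orderIdeal _ _ (neg_mem (ih _ _ _))
    · have h1 := hM (max M M') (le_max_left _ _) a p
      have h2 := hM' (max M M') (le_max_right _ _) a q
      have h3 := sub_mem (Ideal.mul_mem_right (Y q) _ h1) (Ideal.mul_mem_left _ (X p) h2)
      convert h3 using 1
      ring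

/-! ### Binomial coefficients -/

lemma binom_zero (x : ℚ) : binom x 0 = 1 := by simp [binom]

lemma binom_succ (x : ℚ) (j : ℕ) : binom x (j + 1) = binom x j * (x - j) / (j + 1) := by
  have h1 : ((j : ℚ) + 1) ≠ 0 := by positivity
  have h2 : ((j.factorial : ℕ) : ℚ) ≠ 0 := by positivity
  rw [binom, binom, Finset.prod_range_succ, Nat.factorial_succ]
  push_cast
  field_simp

lemma binom_pascal (x : ℚ) (j : ℕ) : binom (x + 1) (j + 1) = binom x (j + 1) + binom x j := by
  have h1 : ((j : ℚ) + 1) ≠ 0 := by positivity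
  have h2 : ((j.factorial : ℕ) : ℚ) ≠ 0 := by positivity
  have h3 : ∏ i ∈ Finset.range (j + 1), (x + 1 - (i : ℕ)) =
      (∏ i ∈ Finset.range j, (x - (i : ℕ))) * (x + 1) := by
    rw [Finset.prod_range_succ']
    simp
  rw [binom_succ x j, binom, h3, binom, Nat.factorial_succ]
  push_cast
  field_simp
  ring

/-- The coefficient of `v ^ (n - 1)` in `(1 - v) ^ (-x - 1)`. -/
def binomPred (x : ℚ) (n : ℕ) : ℚ := if n = 0 then 0 else binom (x + n - 1) (n - 1)

/-- The coefficient of `v ^ n` in `(1 - v) ^ (-x)`. -/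
def binomNeg (x : ℚ) (n : ℕ) : ℚ := binom (x + n - 1) n

lemma binomNeg_succ (x : ℚ) (n : ℕ) :
    binomNeg x (n + 1) = binomNeg (x - 1) (n + 1) + binomNeg x n := by
  have := binom_pascal (x + n - 1) n
  rw [binomNeg, binomNeg, binomNeg]
  push_cast
  convert this using 2 <;> ring_nf

lemma binomPred_succ (x : ℚ) (n : ℕ) :
    binomPred x (n + 1) = binomPred (x - 1) (n + 1) + binomPred x n := by
  rcases n with _ | n
  · simp [binomPred, binom_zero]
  · have := binom_pascal (x + n) n
    simp only [binomPred, Nat.add_eq_zero_iff, one_ne_zero, and_false, if_false, Nat.add_sub_cancel]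
    push_cast
    convert this using 2 <;> ring_nf

lemma binomNeg_eq (x : ℚ) {n : ℕ} (hn : n ≠ 0) :
    binomNeg x n = x * (1 / (n : ℚ) * binom (x + n - 1) (n - 1)) := by
  obtain ⟨n, rfl⟩ := Nat.exists_eq_succ_of_ne_zero hn
  rw [binomNeg, binom_succ]
  simp only [Nat.succ_eq_add_one, Nat.add_sub_cancel]
  push_cast
  ring

lemma binomPred_eq (x : ℚ) {n : ℕ} (hn : n ≠ 0) :
    binomPred x n = n * (1 / (n : ℚ) * binom (x + n - 1) (n - 1)) := by
  have : (n : ℚ) ≠ 0 := by exact_mod_cast hn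
  rw [binomPred, if_neg hn]
  field_simp

/-! ### The numbers `R` and `K` for arbitrary vacancy data -/

lemma formMin_comm (b : P.Base) (h g : Idx b) : formMin b h g = formMin b g h := by
  rw [formMin, formMin, form_comm, min_comm]

/-- The numbers `p_h - ∑_g (α_h | α_g) min (t_g m_h, t_h m_g) N_g`. -/
def vacancy (b : P.Base) (p : Idx b → ℚ) (N : Pattern b) (h : Idx b) : ℚ :=
  p h - N.sum fun g n => formMin b h g * n

/-- An extra string at `h` has the same effect on vacancies as a shift of `p`. This is why the
coefficients are set up for arbitrary rational `p` rather than for `gam b ν`. -/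
lemma vacancy_add_single (b : P.Base) (p : Idx b → ℚ) (N : Pattern b) (h g : Idx b) :
    vacancy b p (N + Finsupp.single h 1) g = vacancy b (p - fun g => formMin b g h) N g := by
  rw [vacancy, vacancy, Finsupp.sum_add_index' (by simp) (by intros; push_cast; ring)]
  simp
  ring

open scoped Classical in
lemma vacancy_sub_single (b : P.Base) (p : Idx b → ℚ) (N : Pattern b) (h g : Idx b) :
    vacancy b (p - ⇑(Finsupp.single h (1 : ℚ))) N g = vacancy b p N g - if g = h then 1 else 0 := by
  simp only [vacancy, Pi.sub_apply, Finsupp.single_apply, eq_comm (a := h)]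
  ring

/-- The number `K(ν, N)` with `p` in place of `γ(ν)`. -/
def coeffK (b : P.Base) (p : Idx b → ℚ) (N : Pattern b) : ℚ :=
  ∏ h ∈ N.support, binom (vacancy b p N h + N h) (N h)

open scoped Classical in
/-- The matrix with `(h, g)` entry the coefficient of `v ^ N_g` in
`(1 - v) ^ (-P_g) (δ_{hg} + A_{hg} v / (1 - v))`. -/
def matR (b : P.Base) (p : Idx b → ℚ) (N : Pattern b) (T : Finset (Idx b)) : Matrix T T ℚ :=
  Matrix.of fun h g => (if h = g then binomNeg (vacancy b p N g) (N g) else 0) +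
    formMin b h g * binomPred (vacancy b p N g) (N g)

open scoped Classical in
/-- The number `R(ν, N)` with `p` in place of `γ(ν)`. -/
def coeffR (b : P.Base) (p : Idx b → ℚ) (N : Pattern b) : ℚ := (matR b p N N.support).det

/-- Each scalar factor of `R(ν, N)` is absorbed into its column. The resulting entries remain
meaningful when `N_g = 0`, where the factor `1 / N_g` is not. -/
lemma numR_eq (b : P.Base) (ν N : Pattern b) : numR b ν N = coeffR b (gam b ν) N := by
  classical
  have h1 : matR b (gam b ν) N N.support =
      Matrix.of fun h g : N.support => (1 / (N g : ℚ) *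
        binom (vac b ν N g + N g - 1) (N g - 1)) * matF b ν N h g := by
    ext h g
    have hg : N g ≠ 0 := Finsupp.mem_support_iff.mp g.2
    have hv : vacancy b (gam b ν) N g = vac b ν N g := rfl
    simp only [matR, matF, Matrix.of_apply, hv, binomNeg_eq _ hg, binomPred_eq _ hg]
    split_ifs with h
    · subst h; ring
    · ring
  rw [coeffR, numR, h1, Matrix.det_mul_row, Finset.prod_coe_sort N.support
    (fun g => 1 / (N g : ℚ) * binom (vac b ν N g + N g - 1) (N g - 1)), mul_comm]

-- A column `g` with `N g = 0` is a unit vector, since `binomNeg x 0 = 1` and `binomPred x 0 = 0`.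
-- Hence the index set may be enlarged, and matrices for different patterns can be compared on a
-- common one.
open scoped Classical in
lemma det_matR (b : P.Base) (p : Idx b → ℚ) (N : Pattern b) {T : Finset (Idx b)}
    (hT : N.support ⊆ T) : (matR b p N T).det = coeffR b p N := by
  rw [Matrix.twoBlockTriangular_det' _ (fun h : T => (h : Idx b) ∈ N.support)]
  · have h1 : (matR b p N T).toSquareBlockProp (fun h : T => (h : Idx b) ∉ N.support) = 1 := by
      ext h g
      have hg : N g.1 = 0 := Finsupp.notMem_support_iff.mp g.2
      simp [Matrix.toSquareBlockProp, matR, hg, binomNeg, binomPred, binom_zero, Matrix.one_apply]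
      exact if_congr Subtype.coe_inj rfl rfl
    rw [h1, Matrix.det_one, mul_one, coeffR]
    let e : {h : T // (h : Idx b) ∈ N.support} ≃ N.support :=
      { toFun := fun h => ⟨h.1.1, h.2⟩
        invFun := fun h => ⟨⟨h.1, hT h.2⟩, h.2⟩
        left_inv := fun _ => rfl
        right_inv := fun _ => rfl }
    rw [← Matrix.det_submatrix_equiv_self e]
    congr 1
    ext h g
    simp [Matrix.toSquareBlockProp, matR, e]
  · intro h hh g hg
    have hg : N g.1 = 0 := Finsupp.notMem_support_iff.mp hg
    have hne : h ≠ g := by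
      rintro rfl
      exact (Finsupp.mem_support_iff.mp hh) hg
    simp [matR, hg, hne, binomPred]

/-! ### The Pascal rule for `K` and `R` -/

/-- The properties that `K` and `R` have in common: locality, normalisation and the Pascal rule. -/
structure IsPascal (b : P.Base) (c : (Idx b → ℚ) → Pattern b → ℚ) : Prop where
  congr : ∀ p p' N, (∀ h ∈ N.support, p h = p' h) → c p N = c p' N
  zero : ∀ p, c p 0 = 1
  pascal : ∀ p N h, c p (N + Finsupp.single h 1) =
    c (p - ⇑(Finsupp.single h (1 : ℚ))) (N + Finsupp.single h 1) + c (p - fun g => formMin b g h) N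

/-- All three vacancies can be evaluated at `N + Finsupp.single h 1`. The factors at `g ≠ h` then
coincide, and the factor at `h` is Pascal's rule. -/
lemma isPascal_coeffK (b : P.Base) : IsPascal b (coeffK b) where
  congr p p' N hp := Finset.prod_congr rfl fun h hh => by rw [vacancy, vacancy, hp h hh]
  zero p := by simp [coeffK]
  pascal p N h := by
    classical
    have h0 : h ∈ (N + Finsupp.single h 1).support := by simp
    have hsub : N.support ⊆ (N + Finsupp.single h 1).support := by
      intro g hg
      simp only [Finsupp.mem_support_iff, Finsupp.add_apply] at hg ⊢
      omega
    have h2 : coeffK b (p - fun g => formMin b g h) N = ∏ g ∈ (N + Finsupp.single h 1).support,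
        binom (vacancy b p (N + Finsupp.single h 1) g + N g) (N g) := by
      rw [coeffK]
      simp_rw [vacancy_add_single]
      refine Finset.prod_subset hsub fun g _ hg => ?_
      rw [Finsupp.notMem_support_iff.mp hg, binom_zero]
    have h3 : ∏ g ∈ (N + Finsupp.single h 1).support.erase h,
          binom (vacancy b p (N + Finsupp.single h 1) g + (N + Finsupp.single h 1 : Pattern b) g)
            ((N + Finsupp.single h 1 : Pattern b) g) =
        ∏ g ∈ (N + Finsupp.single h 1).support.erase h,
          binom (vacancy b p (N + Finsupp.single h 1) g + N g) (N g) :=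
      Finset.prod_congr rfl fun g hg => by simp [Finset.ne_of_mem_erase hg]
    have h4 : ∏ g ∈ (N + Finsupp.single h 1).support.erase h,
          binom (vacancy b (p - ⇑(Finsupp.single h (1 : ℚ))) (N + Finsupp.single h 1) g +
            (N + Finsupp.single h 1 : Pattern b) g) ((N + Finsupp.single h 1 : Pattern b) g) =
        ∏ g ∈ (N + Finsupp.single h 1).support.erase h,
          binom (vacancy b p (N + Finsupp.single h 1) g + N g) (N g) :=
      Finset.prod_congr rfl fun g hg => by
        simp [vacancy_sub_single, Finset.ne_of_mem_erase hg]
    rw [h2, coeffK, coeffK, ← Finset.mul_prod_erase _ _ h0, ← Finset.mul_prod_erase _ _ h0,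
      ← Finset.mul_prod_erase _ _ h0, h3, h4, ← add_mul, vacancy_sub_single, if_pos rfl,
      Finsupp.add_apply, Finsupp.single_eq_same]
    congr 1
    have := binom_pascal (vacancy b p (N + Finsupp.single h 1) h + N h) (N h)
    push_cast
    convert this using 2 <;> ring_nf

/-- Column `g` depends on `p` and `N` only through the vacancy and `N` at `g`. The three matrices
therefore differ only in column `h`, where Pascal's rule for `binomNeg` and `binomPred` makes one
column the sum of the other two; the determinant is additive in that column. -/
lemma isPascal_coeffR (b : P.Base) : IsPascal b (coeffR b) where
  congr p p' N hp := by
    rw [coeffR, coeffR]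
    congr 1
    ext h g
    simp only [matR, Matrix.of_apply, vacancy, hp g g.2]
  zero p := by
    have : IsEmpty (0 : Pattern b).support := ⟨fun x => absurd x.2 (Finset.notMem_empty _)⟩
    simp [coeffR, Matrix.det_isEmpty]
  pascal p N h := by
    classical
    set N' := N + Finsupp.single h 1 with hN'
    have h0 : h ∈ N'.support := by simp [hN']
    have hsub : N.support ⊆ N'.support := by
      intro g hg
      simp only [hN', Finsupp.mem_support_iff, Finsupp.add_apply] at hg ⊢
      omega
    let h' : N'.support := ⟨h, h0⟩
    have hcol : ∀ g : N'.support, g ≠ h' → (g : Idx b) ≠ h := fun g hg h => hg (Subtype.ext h)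
    have hNh : N' h = N h + 1 := by simp [hN']
    have hNg : ∀ g, g ≠ h → N' g = N g := fun g hg => by simp [hN', hg]
    have hv : ∀ g, vacancy b (p - ⇑(Finsupp.single h (1 : ℚ))) N' g =
      vacancy b p N' g - if g = h then 1 else 0 := fun g => vacancy_sub_single b p N' h g
    have hv' : ∀ g, vacancy b (p - fun g => formMin b g h) N g = vacancy b p N' g := fun g =>
      (vacancy_add_single b p N h g).symm
    set M := matR b p N' N'.support with hM
    set M₁ := matR b (p - ⇑(Finsupp.single h (1 : ℚ))) N' N'.support with hM₁
    -- The index set is the support of `N'`, which may exceed that of `N`; `det_matR` shows that the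
    -- determinant is still `coeffR` at `N`.
    set M₂ := matR b (p - fun g => formMin b g h) N N'.support with hM₂
    have e₁ : M₁ = M.updateCol h' (fun i => M₁ i h') := by
      ext i g
      by_cases hg : g = h'
      · subst hg; simp
      · rw [Matrix.updateCol_ne hg]
        simp [hM₁, hM, matR, hv, hcol g hg]
    have e₂ : M₂ = M.updateCol h' (fun i => M₂ i h') := by
      ext i g
      by_cases hg : g = h'
      · subst hg; simp
      · rw [Matrix.updateCol_ne hg]
        simp only [hM₂, hM, matR, Matrix.of_apply, hv', hNg _ (hcol g hg)]
    have e : M = M.updateCol h' ((fun i => M₁ i h') + fun i => M₂ i h') := by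
      ext i g
      by_cases hg : g = h'
      · subst hg
        rw [Matrix.updateCol_self]
        simp only [hM₂, hM₁, hM, matR, Matrix.of_apply, hv, hv', Pi.add_apply, h', hNh, if_true]
        rw [binomNeg_succ (vacancy b p N' h), binomPred_succ (vacancy b p N' h)]
        split_ifs <;> ring
      · rw [Matrix.updateCol_ne hg]
    rw [← det_matR b _ N hsub, coeffR, coeffR, ← hM, ← hM₁, ← hM₂, e, Matrix.det_updateCol_add,
      ← e₁, ← e₂]

/-- For `p = 0` the rows of the matrix `F` sum to zero. -/
lemma numR_zero_left (b : P.Base) {N : Pattern b} (hN : N ≠ 0) : numR b 0 N = 0 := by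
  classical
  obtain ⟨h, hh⟩ := Finsupp.support_nonempty_iff.mpr hN
  have : (matF b 0 N).det = 0 := by
    refine Matrix.exists_mulVec_eq_zero_iff.mp ⟨1, fun h1 => ?_, ?_⟩
    · exact one_ne_zero (congrFun h1 ⟨h, hh⟩)
    · ext g
      simp only [Matrix.mulVec, dotProduct, matF, Matrix.of_apply, Pi.one_apply, mul_one,
        Finset.sum_add_distrib, Finset.sum_ite_eq, Finset.mem_univ, if_true, Pi.zero_apply]
      rw [Finset.sum_coe_sort N.support (fun k => formMin b g k * (N k : ℚ))]
      simp [vac, gam, Finsupp.sum]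
  rw [numR, this, zero_mul]

/-! ### The linear recursion of the generating series -/

lemma content_add_single (b : P.Base) (N : Pattern b) (h : Idx b) :
    content b (N + Finsupp.single h 1) = content b N + Finsupp.single h.1 (h.2 : ℕ) := by
  rw [content, content, Finsupp.sum_add_index' (by simp)
    (by intros; rw [mul_add, Finsupp.single_add])]
  rw [Finsupp.sum_single_index (by simp), mul_one]

lemma coeff_genSeries (b : P.Base) (c : Pattern b → ℚ) (d : b.support →₀ ℕ) :
    MvPowerSeries.coeff d (genSeries b c) =
      ((∑ N ∈ (finite_content b d).toFinset, c N : ℚ) : ℂ) := rfl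

/-- Patterns with `N h = 0` cancel in the difference. The others arise uniquely by adding one string
at `h`, which multiplies the monomial by `y_a^m`. -/
lemma genSeries_sub (b : P.Base) {c c' c'' : Pattern b → ℚ} {h : Idx b}
    (h0 : ∀ N, N h = 0 → c N = c' N)
    (h1 : ∀ N, c (N + Finsupp.single h 1) = c' (N + Finsupp.single h 1) + c'' N) :
    genSeries b c - genSeries b c' = MvPowerSeries.X h.1 ^ (h.2 : ℕ) * genSeries b c'' := by
  classical
  ext d
  rw [MvPowerSeries.X_pow_eq, MvPowerSeries.coeff_monomial_mul, map_sub, coeff_genSeries,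
    coeff_genSeries, coeff_genSeries, ← Rat.cast_sub, ← Finset.sum_sub_distrib,
    ← Finset.sum_filter_of_ne (p := fun N : Pattern b => N h ≠ 0)]
  swap
  · intro N _ hN h'
    exact hN (by rw [h0 N h', sub_self])
  have hpos := h.2.pos
  split_ifs with hd
  · rw [one_mul]
    congr 1
    symm
    refine Finset.sum_bij' (fun N _ => N + Finsupp.single h 1) (fun N _ => N - Finsupp.single h 1)
      ?_ ?_ ?_ ?_ ?_
    · intro N hN
      simp only [Set.Finite.mem_toFinset, Set.mem_ofPred_eq] at hN
      simp [content_add_single, hN, tsub_add_cancel_of_le hd]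
    · intro N hN
      simp only [Finset.mem_filter, Set.Finite.mem_toFinset, Set.mem_ofPred_eq] at hN ⊢
      have h2 : N - Finsupp.single h 1 + Finsupp.single h 1 = N :=
        tsub_add_cancel_of_le (by simpa [Nat.one_le_iff_ne_zero] using hN.2)
      rw [← hN.1]
      conv_rhs => rw [← h2, content_add_single]
      simp
    · intro N _; simp
    · intro N hN
      simp only [Finset.mem_filter] at hN
      exact tsub_add_cancel_of_le (by simpa [Nat.one_le_iff_ne_zero] using hN.2)
    · intro N _
      rw [h1]; ring
  · rw [Finset.sum_eq_zero, Rat.cast_zero]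
    intro N hN
    simp only [Finset.mem_filter, Set.Finite.mem_toFinset, Set.mem_ofPred_eq] at hN
    refine absurd ?_ hd
    rw [Finsupp.single_le_iff, ← hN.1]
    exact (Nat.le_mul_of_pos_right _ (Nat.pos_of_ne_zero hN.2)).trans (le_content b N h)

lemma constantCoeff_genSeries (b : P.Base) (c : Pattern b → ℚ) (hc : c 0 = 1) :
    MvPowerSeries.constantCoeff (genSeries b c) = 1 := by
  have h1 : (finite_content b 0).toFinset = {0} := by
    ext N
    simp only [Set.Finite.mem_toFinset, Set.mem_ofPred_eq, Finset.mem_singleton]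
    constructor
    · intro hN
      ext h
      have := le_content b N h
      rw [hN, Finsupp.zero_apply, Nat.le_zero, mul_eq_zero] at this
      exact this.resolve_left h.2.pos.ne'
    · rintro rfl
      simp [content]
  rw [← MvPowerSeries.coeff_zero_eq_constantCoeff_apply, coeff_genSeries, h1]
  simp [hc]

/-! ### The map `γ` on integral patterns -/

open scoped Classical in
/-- `γ_m^{(a)}(ν)` for integral patterns `ν`, as an additive function of `ν`. -/
def gammaHom (b : P.Base) : IntPattern b.support →+ (Idx b → ℚ) :=
  Finsupp.liftAddHom fun g => AddMonoidHom.mk'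
    (fun n h => if g.1 = h.1 then min ((h.2 : ℕ) : ℚ) ((g.2 : ℕ) : ℚ) * n else 0)
    (fun m n => by
      ext h
      simp only [Pi.add_apply]
      split_ifs <;> push_cast <;> ring)

open scoped Classical in
lemma gammaHom_apply (b : P.Base) (ν : IntPattern b.support) (h : Idx b) :
    gammaHom b ν h =
      ν.sum fun g n => if g.1 = h.1 then min ((h.2 : ℕ) : ℚ) ((g.2 : ℕ) : ℚ) * n else 0 := by
  rw [gammaHom, Finsupp.liftAddHom_apply, Finsupp.sum, Finset.sum_apply]
  rfl

/-- A pattern as an integral pattern. -/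
def toInt (b : P.Base) (ν : Pattern b) : IntPattern b.support :=
  ν.mapRange (fun n : ℕ => (n : ℤ)) Nat.cast_zero

lemma gammaHom_toInt (b : P.Base) (ν : Pattern b) : gammaHom b (toInt b ν) = gam b ν := by
  classical
  ext h
  rw [gammaHom_apply, toInt, Finsupp.sum_mapRange_index (by simp)]
  simp [gam]

open scoped Classical in
lemma gammaHom_level (b : P.Base) (a : b.support) (m : ℕ) (h : Idx b) :
    gammaHom b (level a m) h = if a = h.1 then (min (h.2 : ℕ) m : ℕ) else 0 := by
  rcases Nat.eq_zero_or_pos m with rfl | hm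
  · simp [level_zero]
  · have := level_coe a ⟨m, hm⟩
    rw [PNat.mk_coe] at this
    rw [this, gammaHom_apply, Finsupp.sum_single_index (by simp)]
    simp

/-- As a function of `m`, `min (k, m)` is piecewise linear with a single kink, at `m = k`. -/
lemma gammaHom_levelBend (b : P.Base) (h : Idx b) :
    gammaHom b (levelBend h) = ⇑(Finsupp.single h (1 : ℚ)) := by
  classical
  ext g
  simp only [levelBend, map_add, map_sub, Pi.add_apply, Pi.sub_apply, gammaHom_level,
    Finsupp.single_apply]
  obtain ⟨a, m⟩ := h
  obtain ⟨c, k⟩ := g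
  have hm := m.pos
  by_cases hac : a = c
  · subst hac
    simp only [if_true, Prod.mk.injEq, true_and]
    have key : min (k : ℕ) (m : ℕ) + min (k : ℕ) (m : ℕ) =
        min (k : ℕ) ((m : ℕ) + 1) + min (k : ℕ) ((m : ℕ) - 1) + if m = k then 1 else 0 := by
      split_ifs with h
      · subst h; omega
      · have : (m : ℕ) ≠ k := fun h' => h (PNat.coe_inj.mp h')
        omega
    have key' := congrArg (Nat.cast (R := ℚ)) key
    push_cast at key' ⊢
    linarith
  · simp [hac]

lemma gammaHom_levelStep (b : P.Base) (a : b.support) (m : ℕ) (h : Idx b) (hm : (h.2 : ℕ) ≤ m) :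
    gammaHom b (levelStep a m) h = 0 := by
  classical
  simp only [levelStep, map_sub, Pi.sub_apply, gammaHom_level]
  rw [min_eq_left hm, min_eq_left (hm.trans (Nat.le_succ m)), sub_self]

/-- The exponents of the `Q`-system at `h`. -/
def formPattern (b : P.Base) (h : Idx b) : IntPattern b.support :=
  Finsupp.ofSupportFinite (fun g => formB b h g) (finite_formB b h)

/-- Summation by parts. -/
lemma sum_range_min_mul (f : ℕ → ℚ) (h0 : f 0 = 0) (j n : ℕ) :
    ∑ k ∈ Finset.range n, (min j (k + 1) : ℕ) * (2 * f (k + 1) - f (k + 2) - f k) =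
      f (min j n) + (min j n : ℕ) * (f n - f (n + 1)) := by
  induction n with
  | zero => simp [h0]
  | succ n ih =>
    rw [Finset.sum_range_succ, ih]
    rcases le_or_gt j n with h | h
    · rw [min_eq_left h, min_eq_left (by omega : j ≤ n + 1)]
      ring
    · rw [min_eq_right h.le, min_eq_right (by omega : n + 1 ≤ j)]
      push_cast
      ring

/-- For a fixed node `c`, `B` is the negative second difference in `k` of `min (t_c m, t_a k)`.
Summation against `min (j, k)` inverts this operation. -/
lemma gammaHom_formPattern (b : P.Base) (h : Idx b) :
    gammaHom b (formPattern b h) = fun g => formMin b g h := by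
  classical
  ext g
  obtain ⟨c, j⟩ := g
  rw [gammaHom_apply]
  set f : ℕ → ℚ := fun k => min (t b c * (h.2 : ℕ)) (t b h.1 * (k : ℕ)) with hf
  have hta := t_pos b h.1
  have htc := t_pos b c
  obtain ⟨n₁, hn₁⟩ := exists_nat_ge (t b c * (h.2 : ℕ) / t b h.1)
  obtain ⟨n₂, hn₂⟩ : ∃ n₂ : ℕ, ∀ g ∈ (formPattern b h).support, (g.2 : ℕ) ≤ n₂ :=
    ⟨(formPattern b h).support.sup fun g => (g.2 : ℕ),
      fun g hg => Finset.le_sup (f := fun g : Idx b => (g.2 : ℕ)) hg⟩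
  -- Beyond `n₁` the function `f` is constant, `n₂` bounds the levels in the support, and `j ≤ n`
  -- gives `min j n = j`. Summation by parts up to `n` thus leaves only `f j`.
  set n := max (max n₁ n₂) (j : ℕ) with hn
  have hfn : ∀ k, n ≤ k → f k = t b c * (h.2 : ℕ) := by
    intro k hk
    apply min_eq_left
    have h1 : (n₁ : ℚ) ≤ k := by
      exact_mod_cast ((le_max_left _ _).trans (le_max_left _ _)).trans hk
    have h2 := hn₁.trans h1
    rw [div_le_iff₀ hta] at h2
    linarith
  have f0 : f 0 = 0 := by
    simp only [hf, Nat.cast_zero, mul_zero]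
    exact min_eq_right (by positivity)
  have key := sum_range_min_mul f f0 j n
  rw [min_eq_left (le_max_right _ _), hfn n le_rfl, hfn (n + 1) (Nat.le_succ n), sub_self,
    mul_zero, add_zero] at key
  have h3 : ((formPattern b h).sum fun g z =>
      if g.1 = c then min ((j : ℕ) : ℚ) ((g.2 : ℕ) : ℚ) * z else 0) =
      ∑ k ∈ Finset.range n, (min (j : ℕ) (k + 1) : ℕ) *
        (formB b h (c, k.succPNat) : ℚ) := by
    let e : ℕ ↪ Idx b := ⟨fun k => (c, k.succPNat), fun k l hkl => by
      simpa using hkl⟩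
    have h4 : ∑ k ∈ Finset.range n, (min (j : ℕ) (k + 1) : ℕ) * (formB b h (c, k.succPNat) : ℚ) =
        ∑ g ∈ (Finset.range n).map e, if g.1 = c then min ((j : ℕ) : ℚ) ((g.2 : ℕ) : ℚ) *
          (formPattern b h g : ℤ) else 0 := by
      rw [Finset.sum_map]
      refine Finset.sum_congr rfl fun k _ => ?_
      change _ = if c = c then min ((j : ℕ) : ℚ) ((k.succPNat : ℕ) : ℚ) *
        (formB b h (c, k.succPNat) : ℤ) else 0
      simp
    rw [h4, Finsupp.sum]
    apply Finset.sum_congr_of_eq_on_inter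
    · rintro ⟨c', k⟩ hg hg'
      rw [if_neg]
      rintro rfl
      refine hg' (Finset.mem_map.mpr ⟨k.natPred, ?_, ?_⟩)
      · have := hn₂ _ hg
        have h5 := k.pos
        have h6 : n₂ ≤ n := (le_max_right _ _).trans (le_max_left _ _)
        simp only [Finset.mem_range, PNat.natPred]
        simp only at this
        omega
      · exact Prod.ext rfl (PNat.succPNat_natPred k)
    · intro g _ hg'
      rw [Finsupp.notMem_support_iff.mp hg']
      simp
    · intros; rfl
  change ((formPattern b h).sum fun g z =>
      if g.1 = c then min ((j : ℕ) : ℚ) ((g.2 : ℕ) : ℚ) * z else 0) = _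
  rw [h3]
  have h7 : formMin b (c, j) h = form b h.1 c * f j := by
    rw [formMin_comm]
    rfl
  rw [h7, ← key, Finset.mul_sum]
  refine Finset.sum_congr rfl fun k _ => ?_
  rw [cast_formB, bFun]
  simp only [hf, Nat.succPNat_coe, Nat.succ_eq_add_one]
  push_cast
  rw [add_sub_cancel_right, add_assoc (k : ℚ) 1 1, one_add_one_eq_two]
  ring

/-! ### The series of `K` and `R` as stable solutions -/

/-- The generating series of a family of coefficients, as a function of integral patterns. -/
def series (b : P.Base) (c : (Idx b → ℚ) → Pattern b → ℚ) (ν : IntPattern b.support) :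
    MvPowerSeries b.support ℂ :=
  genSeries b (c (gammaHom b ν))

lemma IsPascal.isRecursive {b : P.Base} {c : (Idx b → ℚ) → Pattern b → ℚ} (hc : IsPascal b c) :
    IsRecursive (formPattern b) (series b c) := by
  classical
  intro ν h
  refine genSeries_sub b (fun N hN => ?_) (fun N => ?_)
  · refine hc.congr _ _ _ fun g hg => ?_
    have hne : g ≠ h := by
      rintro rfl
      exact Finsupp.mem_support_iff.mp hg hN
    simp [gammaHom_levelBend, hne.symm]
  · rw [hc.pascal, map_sub, map_sub, gammaHom_levelBend, gammaHom_formPattern]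

lemma snd_le_degree (b : P.Base) {N : Pattern b} {h : Idx b} (hh : h ∈ N.support) :
    (h.2 : ℕ) ≤ (content b N).degree :=
  ((Nat.le_mul_of_pos_right _ (Nat.pos_of_ne_zero (Finsupp.mem_support_iff.mp hh))).trans
    (le_content b N h)).trans (Finsupp.le_degree h.1 _)

/-- A pattern contributing in degree below `d` has only strings of length below `d`, and its
coefficient reads `p` only on its support. -/
lemma IsPascal.series_sub_mem {b : P.Base} {c : (Idx b → ℚ) → Pattern b → ℚ} (hc : IsPascal b c)
    {d : ℕ} {μ ν : IntPattern b.support}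
    (h : ∀ g : Idx b, (g.2 : ℕ) ≤ d → gammaHom b μ g = gammaHom b ν g) :
    series b c μ - series b c ν ∈ orderIdeal b.support d := by
  rw [mem_orderIdeal]
  intro n hn
  rw [map_sub, sub_eq_zero, series, series, coeff_genSeries, coeff_genSeries]
  congr 1
  refine Finset.sum_congr rfl fun N hN => hc.congr _ _ _ fun g hg => h g ?_
  simp only [Set.Finite.mem_toFinset, Set.mem_ofPred_eq] at hN
  have := snd_le_degree b hg
  rw [hN] at this
  omega

lemma IsPascal.isStable {b : P.Base} {c : (Idx b → ℚ) → Pattern b → ℚ} (hc : IsPascal b c) :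
    IsStable (series b c) := fun d =>
  ⟨d, fun m hm a ν => hc.series_sub_mem fun g hg => by
    rw [map_sub, Pi.sub_apply, gammaHom_levelStep b a m g (hg.trans hm), sub_zero]⟩

lemma series_toInt_coeffR (b : P.Base) (ν : Pattern b) :
    series b (coeffR b) (toInt b ν) = Rtilde b ν := by
  rw [series, gammaHom_toInt, Rtilde]
  congr 1
  ext N
  rw [numR_eq]

lemma series_toInt_coeffK (b : P.Base) (ν : Pattern b) :
    series b (coeffK b) (toInt b ν) = Ktilde b ν := by
  rw [series, gammaHom_toInt]
  rfl

lemma toInt_zero (b : P.Base) : toInt b 0 = 0 := Finsupp.mapRange_zero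

lemma Rtilde_zero (b : P.Base) : Rtilde b 0 = 1 := by
  classical
  ext d
  rw [Rtilde, coeff_genSeries, MvPowerSeries.coeff_one]
  split_ifs with hd
  · subst hd
    have := constantCoeff_genSeries b (numR b 0) (numR_zero b 0)
    rwa [← MvPowerSeries.coeff_zero_eq_constantCoeff_apply, coeff_genSeries] at this
  · rw [Finset.sum_eq_zero, Rat.cast_zero]
    intro N hN
    simp only [Set.Finite.mem_toFinset, Set.mem_ofPred_eq] at hN
    refine numR_zero_left b ?_
    rintro rfl
    exact hd (by rw [← hN]; simp [content])

lemma constantCoeff_Ktilde (b : P.Base) (ν : Pattern b) :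
    MvPowerSeries.constantCoeff (Ktilde b ν) = 1 :=
  constantCoeff_genSeries b _ ((isPascal_coeffK b).zero _)

lemma Rtilde_mul_Ktilde_zero (b : P.Base) (ν : Pattern b) :
    Rtilde b ν * Ktilde b 0 = Ktilde b ν := by
  -- With `p = q = 0` and `r = -ν` the identity reads `K^ν R^0 = K^0 R^ν`.
  have := (isPascal_coeffK b).isRecursive.exchange (isPascal_coeffR b).isRecursive
    (isPascal_coeffK b).isStable (isPascal_coeffR b).isStable 0 0 (-toInt b ν)
  rw [zero_sub, neg_neg, series_toInt_coeffK, series_toInt_coeffR,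
    ← toInt_zero, series_toInt_coeffK, series_toInt_coeffR, Rtilde_zero, mul_one] at this
  rw [this, mul_comm]

/-! ### The `Q`-system as a linear recursion -/

/-- The product `∏ (Q_m^{(a)}) ^ ν_m^{(a)}` as an additive function of the integral pattern `ν`. -/
def powHom (b : P.Base) (Q : b.support → ℕ → (MvPowerSeries b.support ℂ)ˣ) :
    IntPattern b.support →+ Additive (MvPowerSeries b.support ℂ)ˣ :=
  Finsupp.liftAddHom fun h => zmultiplesHom _ (Additive.ofMul (Q h.1 h.2))

/-- The product `∏ (Q_m^{(a)}) ^ ν_m^{(a)}` for an integral pattern `ν`. -/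
def intPow (b : P.Base) (Q : b.support → ℕ → (MvPowerSeries b.support ℂ)ˣ)
    (ν : IntPattern b.support) : (MvPowerSeries b.support ℂ)ˣ :=
  (powHom b Q ν).toMul

lemma intPow_eq_prod (b : P.Base) (Q : b.support → ℕ → (MvPowerSeries b.support ℂ)ˣ)
    (ν : IntPattern b.support) : intPow b Q ν = ν.prod fun h n => Q h.1 h.2 ^ n := rfl

lemma intPow_add (b : P.Base) (Q : b.support → ℕ → (MvPowerSeries b.support ℂ)ˣ)
    (μ ν : IntPattern b.support) : intPow b Q (μ + ν) = intPow b Q μ * intPow b Q ν := by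
  rw [intPow, map_add]; rfl

lemma intPow_sub (b : P.Base) (Q : b.support → ℕ → (MvPowerSeries b.support ℂ)ˣ)
    (μ ν : IntPattern b.support) : intPow b Q (μ - ν) = intPow b Q μ / intPow b Q ν := by
  rw [intPow, map_sub]; rfl

lemma intPow_level (b : P.Base) {Q : b.support → ℕ → (MvPowerSeries b.support ℂ)ˣ}
    (h0 : ∀ a, Q a 0 = 1) (a : b.support) (m : ℕ) : intPow b Q (level a m) = Q a m := by
  rcases Nat.eq_zero_or_pos m with rfl | hm
  · rw [level_zero, intPow, map_zero, h0]; rfl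
  · have := level_coe a ⟨m, hm⟩
    rw [PNat.mk_coe] at this
    rw [this, intPow_eq_prod, Finsupp.prod_single_index (by simp), zpow_one]
    rfl

lemma intPow_toInt (b : P.Base) (Q : b.support → ℕ → (MvPowerSeries b.support ℂ)ˣ)
    (ν : Pattern b) : (intPow b Q (toInt b ν) : MvPowerSeries b.support ℂ) = Qtilde b Q ν := by
  rw [intPow_eq_prod, toInt, Finsupp.prod_mapRange_index (by simp), Qtilde, Finsupp.prod,
    Finsupp.prod, Units.coe_prod]
  simp

lemma intPow_formPattern (b : P.Base) (Q : b.support → ℕ → (MvPowerSeries b.support ℂ)ˣ)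
    (h : Idx b) :
    ∏ᶠ g : Idx b, Q g.1 g.2 ^ (-formB b h g) = (intPow b Q (formPattern b h))⁻¹ := by
  rw [intPow_eq_prod, Finsupp.prod, finprod_eq_prod_of_mulSupport_subset _
    (s := (formPattern b h).support), ← Finset.prod_inv_distrib]
  · exact Finset.prod_congr rfl fun g _ => zpow_neg _ _
  · intro g hg
    rw [Finset.mem_coe, Finsupp.mem_support_iff]
    intro h0
    have h1 : formB b h g = 0 := h0
    exact hg (by simp [h1])

/-- Each of the three terms of the recursion at `ν` is the unit `Q^(ν - 2e)`, with `e` the basis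
pattern at `(a, m)`, times the corresponding term of the `Q`-system. -/
lemma qSystem_iff (b : P.Base) (Q : b.support → ℕ → (MvPowerSeries b.support ℂ)ˣ) :
    QSystem b Q ↔ (∀ a, Q a 0 = 1) ∧ IsRecursive (formPattern b)
      fun ν => (intPow b Q ν : MvPowerSeries b.support ℂ) := by
  refine and_congr_right fun h0 => ?_
  have e1 : ∀ (ν : IntPattern b.support) (a : b.support) (m : ℕ+),
      (intPow b Q ν : MvPowerSeries b.support ℂ) =
        (intPow b Q (ν - level a m - level a m) : MvPowerSeries b.support ℂ) *
          (Q a m : MvPowerSeries b.support ℂ) ^ 2 := by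
    intro ν a m
    rw [← Units.val_pow_eq_pow_val, ← Units.val_mul, intPow_sub, intPow_sub, intPow_level b h0]
    rw [div_div, ← pow_two, div_mul_cancel]
  have e2 : ∀ (ν : IntPattern b.support) (a : b.support) (m : ℕ+),
      (intPow b Q (ν - levelBend (a, m)) : MvPowerSeries b.support ℂ) =
        (intPow b Q (ν - level a m - level a m) : MvPowerSeries b.support ℂ) *
          ((Q a ((m : ℕ) + 1) : MvPowerSeries b.support ℂ) *
            (Q a ((m : ℕ) - 1) : MvPowerSeries b.support ℂ)) := by
    intro ν a m
    have : ν - levelBend (a, m) =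
        ν - level a m - level a m + (level a ((m : ℕ) + 1) + level a ((m : ℕ) - 1)) := by
      rw [levelBend]; abel
    rw [this, intPow_add, intPow_add, intPow_level b h0, intPow_level b h0, Units.val_mul,
      Units.val_mul]
  have e3 : ∀ (ν : IntPattern b.support) (a : b.support) (m : ℕ+),
      (intPow b Q (ν - formPattern b (a, m)) : MvPowerSeries b.support ℂ) =
        (intPow b Q (ν - level a m - level a m) : MvPowerSeries b.support ℂ) *
          ((Q a m : MvPowerSeries b.support ℂ) ^ 2 *
            ((∏ᶠ g : Idx b, Q g.1 g.2 ^ (-formB b (a, m) g) : (MvPowerSeries b.support ℂ)ˣ) :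
              MvPowerSeries b.support ℂ)) := by
    intro ν a m
    rw [← mul_assoc, ← e1, intPow_formPattern, intPow_sub, div_eq_mul_inv, Units.val_mul]
  constructor
  · rintro h ν ⟨a, m⟩
    have := h a m
    simp only
    rw [e1 ν a m, e2 ν a m, e3 ν a m]
    linear_combination (intPow b Q (ν - level a m - level a m) : MvPowerSeries b.support ℂ) * this
  · intro h a m
    -- At this `ν` the common factor is `Q^0 = 1`.
    have := h (level a m + level a m) (a, m)
    simp only at this
    rw [e1 _ a m, e2 _ a m, e3 _ a m, add_sub_cancel_right, sub_self] at this
    have h1 : (intPow b Q 0 : MvPowerSeries b.support ℂ) = 1 := by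
      rw [intPow, map_zero]; rfl
    rw [h1] at this
    linear_combination this

lemma QConverges.exists_sub_mem {b : P.Base}
    {Q : b.support → ℕ → (MvPowerSeries b.support ℂ)ˣ} (hQ : QConverges b Q) (d : ℕ) :
    ∃ M : ℕ, ∀ m, M ≤ m → ∀ a, (Q a m : MvPowerSeries b.support ℂ) - (Q a (m + 1) :
      MvPowerSeries b.support ℂ) ∈ orderIdeal b.support d := by
  -- One `M` serves all nodes and all coefficients of degree below `d`, since both are finite in
  -- number.
  have h1 : ∀ᶠ M in atTop, ∀ a, ∀ n ∈ {n : b.support →₀ ℕ | n.degree < d}, ∀ m, M ≤ m →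
      MvPowerSeries.coeff n (Q a m : MvPowerSeries b.support ℂ) =
        MvPowerSeries.coeff n (hQ a).choose := by
    refine eventually_all.mpr fun a => (eventually_all_finite ?_).mpr fun n _ => ?_
    · exact Finsupp.finite_of_degree_lt d
    · have h2 := (hQ a).choose_spec
      have h3 := (@tendsto_pi_nhds _ _ (fun _ => ℂ) (fun _ => ⊥) _ _ _).mp h2 n
      rw [@nhds_discrete ℂ ⊥ (@DiscreteTopology.mk ℂ ⊥ rfl), tendsto_pure] at h3
      exact eventually_forall_ge_atTop.mpr h3
  obtain ⟨M, hM⟩ := h1.exists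
  refine ⟨M, fun m hm a => mem_orderIdeal.mpr fun n hn => ?_⟩
  rw [map_sub, hM a n hn m hm, hM a n hn (m + 1) (by omega), sub_self]

/-- The change of `Q^ν` under a step is a multiple of `Q_m - Q_{m+1}`, so the bound does not depend
on `ν`. -/
lemma QConverges.isStable {b : P.Base} {Q : b.support → ℕ → (MvPowerSeries b.support ℂ)ˣ}
    (h0 : ∀ a, Q a 0 = 1) (hQ : QConverges b Q) :
    IsStable fun ν => (intPow b Q ν : MvPowerSeries b.support ℂ) := by
  intro d
  obtain ⟨M, hM⟩ := hQ.exists_sub_mem d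
  refine ⟨M, fun m hm a ν => ?_⟩
  have h1 : (intPow b Q (ν - levelStep a m) : MvPowerSeries b.support ℂ) =
      (intPow b Q (ν - level a (m + 1)) : MvPowerSeries b.support ℂ) * Q a m := by
    have : ν - levelStep a m = ν - level a (m + 1) + level a m := by rw [levelStep]; abel
    rw [this, intPow_add, intPow_level b h0, Units.val_mul]
  have h2 : (intPow b Q ν : MvPowerSeries b.support ℂ) =
      (intPow b Q (ν - level a (m + 1)) : MvPowerSeries b.support ℂ) * Q a (m + 1) := by
    conv_lhs => rw [← sub_add_cancel ν (level a (m + 1))]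
    rw [intPow_add, intPow_level b h0, Units.val_mul]
  simp only
  rw [h1, h2, ← mul_sub]
  exact Ideal.mul_mem_left _ _ (hM m hm a)

/-! ### The canonical solution -/

lemma isUnit_series_coeffK (b : P.Base) (ν : IntPattern b.support) :
    IsUnit (series b (coeffK b) ν) := by
  rw [MvPowerSeries.isUnit_iff_constantCoeff, series,
    constantCoeff_genSeries b _ ((isPascal_coeffK b).zero _)]
  exact isUnit_one

lemma isUnit_Ktilde (b : P.Base) (ν : Pattern b) : IsUnit (Ktilde b ν) := by
  rw [← series_toInt_coeffK]
  exact isUnit_series_coeffK b _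

/-- The exchange identity of `K` with itself; it makes `K^ν / K^0` a homomorphism in `ν`. -/
lemma series_coeffK_add (b : P.Base) (μ ν : IntPattern b.support) :
    series b (coeffK b) (μ + ν) * series b (coeffK b) 0 =
      series b (coeffK b) μ * series b (coeffK b) ν := by
  have := (isPascal_coeffK b).isRecursive.exchange (isPascal_coeffK b).isRecursive
    (isPascal_coeffK b).isStable (isPascal_coeffK b).isStable μ 0 (-ν)
  rwa [sub_neg_eq_add, zero_sub, neg_neg] at this

/-- The quotients of the series `K`, as an additive function of the integral pattern. -/
def quotHom (b : P.Base) : IntPattern b.support →+ Additive (MvPowerSeries b.support ℂ)ˣ :=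
  AddMonoidHom.mk' (fun ν => Additive.ofMul
    ((isUnit_series_coeffK b ν).unit / (isUnit_series_coeffK b 0).unit)) fun μ ν => by
    rw [← ofMul_mul, Additive.ofMul.injective.eq_iff, div_mul_div_comm, div_eq_div_iff_mul_eq_mul]
    ext1
    have := series_coeffK_add b μ ν
    simp only [Units.val_mul, IsUnit.unit_spec]
    rw [← mul_assoc, this]

/-- The canonical solution of the `Q`-system. -/
def canonicalQ (b : P.Base) (a : b.support) (m : ℕ) : (MvPowerSeries b.support ℂ)ˣ :=
  (quotHom b (level a m)).toMul

lemma canonicalQ_zero (b : P.Base) (a : b.support) : canonicalQ b a 0 = 1 := by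
  rw [canonicalQ, level_zero, map_zero]; rfl

lemma intPow_canonicalQ (b : P.Base) (ν : IntPattern b.support) :
    (intPow b (canonicalQ b) ν : MvPowerSeries b.support ℂ) * series b (coeffK b) 0 =
      series b (coeffK b) ν := by
  have h1 : powHom b (canonicalQ b) = quotHom b := by
    refine Finsupp.addHom_ext' fun h => AddMonoidHom.ext_int ?_
    have h2 := level_coe h.1 h.2
    change powHom b (canonicalQ b) (Finsupp.single h 1) = quotHom b (Finsupp.single h 1)
    rw [show h = (h.1, h.2) from rfl, ← h2]
    exact congrArg Additive.ofMul (intPow_level b (canonicalQ_zero b) h.1 h.2)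
  have h3 : intPow b (canonicalQ b) ν * (isUnit_series_coeffK b 0).unit =
      (isUnit_series_coeffK b ν).unit := by
    rw [intPow, h1]
    exact div_mul_cancel _ _
  simpa using congrArg Units.val h3

lemma intPow_canonicalQ_eq (b : P.Base) (ν : IntPattern b.support) :
    (intPow b (canonicalQ b) ν : MvPowerSeries b.support ℂ) =
      series b (coeffK b) ν * ((isUnit_series_coeffK b 0).unit⁻¹ : (MvPowerSeries b.support ℂ)ˣ) := by
  rw [Units.eq_mul_inv_iff_mul_eq]
  exact intPow_canonicalQ b ν

lemma qSystem_canonicalQ (b : P.Base) : QSystem b (canonicalQ b) := by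
  refine (qSystem_iff b _).mpr ⟨canonicalQ_zero b, fun ν h => ?_⟩
  have := (isPascal_coeffK b).isRecursive ν h
  simp only [intPow_canonicalQ_eq]
  rw [← sub_mul, this, mul_assoc]

lemma qConverges_canonicalQ (b : P.Base) : QConverges b (canonicalQ b) := by
  intro a
  -- From level `n.degree + 1` on, the coefficient at `n` no longer changes, so it can be read off
  -- there.
  refine ⟨fun n => MvPowerSeries.coeff n
    (canonicalQ b a (n.degree + 1) : MvPowerSeries b.support ℂ), ?_⟩
  refine (@tendsto_pi_nhds _ _ (fun _ => ℂ) (fun _ => ⊥) _ _ _).mpr fun n => ?_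
  rw [@nhds_discrete ℂ ⊥ (@DiscreteTopology.mk ℂ ⊥ rfl), tendsto_pure]
  filter_upwards [eventually_ge_atTop (n.degree + 1)] with m hm
  have h1 := (isPascal_coeffK b).series_sub_mem (d := n.degree + 1) (μ := level a m)
    (ν := level a (n.degree + 1)) fun g hg => by
      classical
      rw [gammaHom_level, gammaHom_level, min_eq_left hg, min_eq_left (hg.trans hm)]
  have h2 := mem_orderIdeal.mp (Ideal.mul_mem_right
    (((isUnit_series_coeffK b 0).unit⁻¹ : (MvPowerSeries b.support ℂ)ˣ) :
      MvPowerSeries b.support ℂ) _ h1) n (Nat.lt_succ_self _)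
  rw [sub_mul, ← intPow_canonicalQ_eq, ← intPow_canonicalQ_eq, intPow_level b (canonicalQ_zero b),
    intPow_level b (canonicalQ_zero b), map_sub, sub_eq_zero] at h2
  exact h2

lemma eq_canonicalQ (b : P.Base) {Q : b.support → ℕ → (MvPowerSeries b.support ℂ)ˣ}
    (h1 : QSystem b Q) (h2 : QConverges b Q) : Q = canonicalQ b := by
  obtain ⟨h0, h3⟩ := (qSystem_iff b Q).mp h1
  obtain ⟨h0', h3'⟩ := (qSystem_iff b _).mp (qSystem_canonicalQ b)
  funext a m
  have := h3.exchange h3' (h2.isStable h0) ((qConverges_canonicalQ b).isStable h0') 0 0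
    (-level a m)
  simp only [zero_sub, neg_neg, intPow_level b h0, intPow_level b h0'] at this
  have e : ∀ Q : b.support → ℕ → (MvPowerSeries b.support ℂ)ˣ,
      (intPow b Q 0 : MvPowerSeries b.support ℂ) = 1 := fun Q => by rw [intPow, map_zero]; rfl
  rw [e, e, mul_one, one_mul] at this
  exact Units.ext this

lemma Qtilde_canonicalQ (b : P.Base) (ν : Pattern b) :
    Qtilde b (canonicalQ b) ν = Rtilde b ν := by
  have h1 := intPow_canonicalQ b (toInt b ν)
  rw [intPow_toInt, series_toInt_coeffK, ← toInt_zero, series_toInt_coeffK,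
    ← Rtilde_mul_Ktilde_zero b ν] at h1
  exact (isUnit_Ktilde b 0).mul_right_cancel h1

/-! ### Laurent series in `x` -/

section Laurent

variable [P.IsRootSystem]

lemma prod_expo (b : P.Base) (ν : Pattern b) :
    (ν.prod fun h n => expo b (fundWeight b h.1) ^ ((h.2 : ℕ) * n)) = expo b (topWeight b ν) := by
  classical
  rw [Finsupp.prod, topWeight, Finsupp.sum]
  induction ν.support using Finset.induction_on with
  | empty => rfl
  | insert h s hs ih =>
    rw [Finset.prod_insert hs, Finset.sum_insert hs, ih, expo, expo, expo, HahnSeries.single_pow,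
      HahnSeries.single_mul_single, one_pow, one_mul]

lemma Qnu_eq (b : P.Base) (Q : b.support → ℕ → (MvPowerSeries b.support ℂ)ˣ) (ν : Pattern b) :
    Qnu b Q ν = (ν.prod fun h n => expo b (fundWeight b h.1) ^ ((h.2 : ℕ) * n)) *
      substY b (Qtilde b Q ν) := by
  rw [Qnu, Qtilde, Finsupp.prod, Finsupp.prod, Finsupp.prod, map_prod, ← Finset.prod_mul_distrib]
  refine Finset.prod_congr rfl fun h _ => ?_
  rw [Qx, mul_pow, ← pow_mul, map_pow]

lemma isUnit_Knu (b : P.Base) (ν : Pattern b) : IsUnit (Knu b ν) := by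
  refine IsUnit.mul ?_ ((isUnit_Ktilde b ν).map _)
  rw [prod_expo]
  refine IsUnit.of_mul_eq_one (expo b (-topWeight b ν)) ?_
  rw [expo, expo, HahnSeries.single_mul_single, add_neg_cancel, one_mul]
  rfl

lemma Rnu_mul_Knu_zero (b : P.Base) (ν : Pattern b) : Rnu b ν * Knu b 0 = Knu b ν := by
  rw [Knu, Finsupp.prod_zero_index, one_mul, Rnu, mul_assoc, ← map_mul, Rtilde_mul_Ktilde_zero, Knu]

lemma yWeight_content (b : P.Base) (N : Pattern b) :
    yWeight b (content b N) = -N.sum fun h n => ((h.2 : ℕ) * n) • simpleRoot b h.1 := by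
  rw [content, map_finsuppSum, Finsupp.sum, Finsupp.sum, ← Finset.sum_neg_distrib]
  refine Finset.sum_congr rfl fun h _ => ?_
  change -Finsupp.sum _ _ = _
  rw [Finsupp.sum_single_index (by simp)]

lemma mem_patternsOfWeight (b : P.Base) (ν N : Pattern b) (lam : Weight b) :
    N ∈ patternsOfWeight b ν lam ↔ topWeight b ν + yWeight b (content b N) = lam := by
  rw [yWeight_content, ← sub_eq_add_neg]
  rfl

/-- Simple roots are linearly independent, so a weight determines the exponent of `y`. Hence the
patterns of a given weight form a fibre of `content`, which is finite. -/
lemma patternsOfWeight_eq (b : P.Base) (ν : Pattern b) (d : b.support →₀ ℕ) :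
    patternsOfWeight b ν (topWeight b ν + yWeight b d) = {N | content b N = d} := by
  ext N
  rw [mem_patternsOfWeight, add_right_inj, (yWeight_injective b).eq_iff]
  rfl

lemma patternsOfWeight_eq_empty (b : P.Base) (ν : Pattern b) {lam : Weight b}
    (h : lam - topWeight b ν ∉ Set.range (yWeight b)) : patternsOfWeight b ν lam = ∅ := by
  refine Set.eq_empty_of_forall_notMem fun N hN => h ⟨content b N, ?_⟩
  rw [mem_patternsOfWeight] at hN
  rw [← hN, add_sub_cancel_left]

lemma finite_patternsOfWeight (b : P.Base) (ν : Pattern b) (lam : Weight b) :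
    (patternsOfWeight b ν lam).Finite := by
  by_cases h : lam - topWeight b ν ∈ Set.range (yWeight b)
  · obtain ⟨d, hd⟩ := h
    rw [← add_sub_cancel (topWeight b ν) lam, ← hd, patternsOfWeight_eq]
    exact finite_content b d
  · rw [patternsOfWeight_eq_empty b ν h]
    exact Set.finite_empty

lemma coeff_Rnu (b : P.Base) (ν : Pattern b) (lam : Weight b) :
    (Rnu b ν).coeff lam = ((∑ᶠ N ∈ patternsOfWeight b ν lam, numR b ν N : ℚ) : ℂ) := by
  have h1 : (Rnu b ν).coeff lam = (substY b (Rtilde b ν)).coeff (lam - topWeight b ν) := by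
    rw [Rnu, prod_expo, expo]
    conv_lhs => rw [← sub_add_cancel lam (topWeight b ν)]
    rw [HahnSeries.coeff_single_mul_add, one_mul]
  rw [h1]
  by_cases h : lam - topWeight b ν ∈ Set.range (yWeight b)
  · obtain ⟨d, hd⟩ := h
    have h2 : patternsOfWeight b ν lam = {N | content b N = d} := by
      rw [← patternsOfWeight_eq b ν d, hd, add_sub_cancel]
    -- The coefficient of the embedded series at `yWeight b d` is that of `Rtilde` at `d`, which is
    -- by definition the sum over the fibre.
    rw [h2, ← hd, finsum_mem_eq_finite_toFinset_sum _ (finite_content b d)]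
    exact HahnSeries.embDomain_coeff
  · rw [patternsOfWeight_eq_empty b ν h, finsum_mem_empty, Rat.cast_zero]
    exact HahnSeries.embDomain_of_notMem_range h

end Laurent

end

end BetheQ

theorem mainTheorem2 {ι 𝕜 V W : Type*} [Fintype ι] [Field 𝕜] [CharZero 𝕜]
    [AddCommGroup V] [Module 𝕜 V] [AddCommGroup W] [Module 𝕜 W]
    (P : RootPairing ι 𝕜 V W) [P.IsRootSystem] [P.IsCrystallographic] [P.IsReduced]
    [P.IsIrreducible] (b : P.Base) :
    ∃ Q : b.support → ℕ → (MvPowerSeries b.support ℂ)ˣ,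
      (BetheQ.QSystem b Q ∧ BetheQ.QConverges b Q ∧
        ∀ Q', BetheQ.QSystem b Q' → BetheQ.QConverges b Q' → Q' = Q) ∧
      IsUnit (BetheQ.Ktilde b 0) ∧ IsUnit (BetheQ.Knu b 0) ∧
      ∀ ν : BetheQ.Pattern b,
        BetheQ.Qtilde b Q ν = BetheQ.Rtilde b ν ∧
        BetheQ.Rtilde b ν = BetheQ.Ktilde b ν * (BetheQ.Ktilde b 0)⁻¹ ∧
        BetheQ.Qnu b Q ν = BetheQ.Rnu b ν ∧
        BetheQ.Rnu b ν = BetheQ.Knu b ν * Ring.inverse (BetheQ.Knu b 0) ∧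
        ∀ lam : BetheQ.Weight b,
          (BetheQ.patternsOfWeight b ν lam).Finite ∧
          (BetheQ.Qnu b Q ν).coeff lam =
            ((∑ᶠ N ∈ BetheQ.patternsOfWeight b ν lam, BetheQ.numR b ν N : ℚ) : ℂ) := by
  have hQR : ∀ ν, BetheQ.Qnu b (BetheQ.canonicalQ b) ν = BetheQ.Rnu b ν := fun ν => by
    rw [BetheQ.Qnu_eq, BetheQ.Qtilde_canonicalQ, BetheQ.Rnu]
  refine ⟨BetheQ.canonicalQ b, ⟨BetheQ.qSystem_canonicalQ b, BetheQ.qConverges_canonicalQ b,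
    fun Q' => BetheQ.eq_canonicalQ b⟩, BetheQ.isUnit_Ktilde b 0, BetheQ.isUnit_Knu b 0,
    fun ν => ⟨BetheQ.Qtilde_canonicalQ b ν, ?_, hQR ν, ?_, fun lam =>
      ⟨BetheQ.finite_patternsOfWeight b ν lam, ?_⟩⟩⟩
  · rw [← BetheQ.Rtilde_mul_Ktilde_zero, mul_assoc, MvPowerSeries.mul_inv_cancel, mul_one]
    rw [BetheQ.constantCoeff_Ktilde]
    exact one_ne_zero
  · rw [← BetheQ.Rnu_mul_Knu_zero, mul_assoc, Ring.mul_inverse_cancel _ (BetheQ.isUnit_Knu b 0),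
      mul_one]
  · rw [hQR, BetheQ.coeff_Rnu]
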